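/- There is a universal constant $c_2>0$ such that the following holds. Let $V$ be a finite set of $n$ points, $G=(V,E)$ an undirected graph, $k\in\mathbb N$, and $0<\varepsilon\le 1$. A $k$-clustering is a partition of $V$ into $k$ labelled, disjoint, possibly empty sets; write $u\equiv_{\mathcal C}v$ if $u,v$ lie in the same cluster of $\mathcal C$. Put $$\operatorname{cost}_{u,v}(\mathcal C)=\mathbf 1_{(u,v)\in E}\mathbf 1_{u\not\equiv_{\mathcal C}v}+\mathbf 1_{(u,v)\notin E}\mathbf 1_{u\equiv_{\mathcal C}v},$$ let $\operatorname{cost}(\mathcal C)$ be the sum of $\operatorname{cost}_{u,v}(\mathcal C)$ over all unordered pairs of distinct points, and let $d(\mathcal C,\mathcal C')$ be the number of unordered pairs on which $\mathcal C$ and $\mathcal C'$ disagree. Fix a (pivot) $k$-clustering $\mathcal C=\{C_1,\dots,C_k\}$ with $|C_1|\ge\cdots\ge|C_k|$, and let $f(\mathcal C')=\operatorname{cost}(\mathcal C')-\operatorname{cost}(\mathcal C)$ and $f_{u,v}(\mathcal C')=\operatorname{cost}_{u,v}(\mathcal C')-\operatorname{cost}_{u,v}(\mathcal C)$. Let $q$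 be an integer with $q\ge c_2k^2\log n/\varepsilon^4$ (for instance the least one). For every $i\le j$ with $C_j\ne\emptyset$ and every $u\in C_i$, draw a sample (multiset) $S_{uj}$ of $q$ elements uniformly with repetition from $C_j$, all draws being independent, and put $$\hat f(\mathcal C')=\frac12\sum_{i=1}^k\frac{|C_i|}{q}\sum_{u\in C_i}\sum_{v\in S_{ui}}f_{u,v}(\mathcal C')+\sum_{i=1}^k\sum_{u\in C_i}\sum_{j=i+1}^k\frac{|C_j|}{q}\sum_{v\in S_{uj}}f_{u,v}(\mathcal C'),$$ where terms with $C_j=\emptyset$ are $0$, and $\hat f=0$ if $q=0$ (which can occur only if $n\le1$). Then with probability at least $1-n^{-3}$, simultaneously for all $k$-clusterings $\mathcal C'$, $$|f(\mathcal C')-\hat f(\mathcal C')|\le 3\varepsilon\, d(\mathcal C,\mathcal C'),$$ that is, $\hat f$ is a $3\varepsilon$-smooth relative regret approximation with respect to $\mathcal C$. -/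

import Mathlib

open MeasureTheory ProbabilityTheory

namespace CorrClust

/-- A `k`-clustering of `V`: a partition of `V` into `k` labelled, possibly empty, disjoint sets,
encoded by the function that sends each point to the label of its cluster. -/
abbrev Clustering (V : Type*) (k : ℕ) := V → Fin k

section

variable {V : Type*} [Fintype V] {k : ℕ}

/-- The cluster with label `j`. -/
def cluster (C : Clustering V k) (j : Fin k) : Finset V :=
  Finset.univ.filter (fun v => C v = j)

/-- The cost of a clustering on the pair `u, v`: it is `1` when the clustering and the graph
disagree on the pair, and `0` otherwise. -/
def pairCost (G : SimpleGraph V) [DecidableRel G.Adj] (C : Clustering V k) (u v : V) : ℝ :=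
  if G.Adj u v then (if C u = C v then 0 else 1) else (if C u = C v then 1 else 0)

/-- The correlation clustering cost: the number of unordered pairs of distinct points on which
the clustering and the graph disagree. -/
noncomputable def cost [DecidableEq V] (G : SimpleGraph V) [DecidableRel G.Adj]
    (C : Clustering V k) : ℝ :=
  (1 / 2) * ∑ u, ∑ v ∈ Finset.univ.filter (fun v => v ≠ u), pairCost G C u v

/-- The distance of two clusterings: the number of unordered pairs on which they disagree. -/
noncomputable def dist (C C' : Clustering V k) : ℝ :=
  (1 / 2) * ∑ u, ∑ v,
    ((if C' u = C' v ∧ C u ≠ C v then 1 else 0) + (if C u = C v ∧ C' u ≠ C' v then 1 else 0))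

/-- The relative regret of `C'` with respect to the pivot `C`. -/
noncomputable def regret [DecidableEq V] (G : SimpleGraph V) [DecidableRel G.Adj]
    (C C' : Clustering V k) : ℝ :=
  cost G C' - cost G C

/-- The contribution of the pair `u, v` to the relative regret of `C'` with respect to `C`. -/
def pairRegret (G : SimpleGraph V) [DecidableRel G.Adj] (C C' : Clustering V k) (u v : V) : ℝ :=
  pairCost G C' u v - pairCost G C u v

/-- `g` is an `η`-smooth relative regret approximation with respect to the pivot `C`. -/
def IsSmoothRegretApprox [DecidableEq V] (G : SimpleGraph V) [DecidableRel G.Adj] (η : ℝ)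
    (C : Clustering V k) (g : Clustering V k → ℝ) : Prop :=
  ∀ C' : Clustering V k, |regret G C C' - g C'| ≤ η * dist C C'

/-- The indices of the random draws: one sample for each point `u` and each label `j` that is at
least the label of the cluster of `u`, and `q` draws in each sample. An empty cluster offers
nothing to draw, so its samples are absent. -/
abbrev SampleIndex (C : Clustering V k) (q : ℕ) :=
  {p : V × Fin k // C p.1 ≤ p.2 ∧ (cluster C p.2).Nonempty} × Fin q

/-- All samples together: the value at the index `((u, j), s)` is the `s`-th element drawn in the
sample of `u` from the cluster `j`. -/
abbrev Sample (C : Clustering V k) (q : ℕ) := SampleIndex C q → V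

/-- The law of the samples: all draws are independent, and each is uniform on its cluster. -/
noncomputable def sampleLaw [MeasurableSpace V] (C : Clustering V k) (q : ℕ) :
    Measure (Sample C q) :=
  Measure.pi (fun x : SampleIndex C q => uniformOn (cluster C x.1.1.2 : Set V))

instance sampleLaw_isProbabilityMeasure [MeasurableSpace V] [DiscreteMeasurableSpace V]
    (C : Clustering V k) (q : ℕ) : IsProbabilityMeasure (sampleLaw C q) := by
  have (x : SampleIndex C q) :
      IsProbabilityMeasure (uniformOn (cluster C x.1.1.2 : Set V)) :=
    isProbabilityMeasure_uniformOn (Finset.finite_toSet _) (Finset.coe_nonempty.2 x.1.2.2)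
  unfold sampleLaw
  infer_instance

/-- The sum of `g` over the sample of `u` from the cluster `j`, counted with repetitions
(zero when there is no such sample). -/
noncomputable def sampleSum {C : Clustering V k} {q : ℕ} (S : Sample C q) (u : V) (j : Fin k)
    (g : V → ℝ) : ℝ :=
  if h : C u ≤ j ∧ (cluster C j).Nonempty then ∑ s : Fin q, g (S (⟨(u, j), h⟩, s)) else 0

/-- The estimator of the relative regret that is computed from the samples. -/
noncomputable def estimator (G : SimpleGraph V) [DecidableRel G.Adj] (C : Clustering V k) {q : ℕ}
    (S : Sample C q) (C' : Clustering V k) : ℝ :=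
  (1 / 2) * ∑ i, ((cluster C i).card : ℝ) / q *
      ∑ u ∈ cluster C i, sampleSum S u i (pairRegret G C C' u)
    + ∑ i, ∑ u ∈ cluster C i, ∑ j ∈ Finset.Ioi i,
        ((cluster C j).card : ℝ) / q * sampleSum S u j (pairRegret G C C' u)

end

end CorrClust

/-! Split the pairs into the blocks `C_i × C_j` with `i ≤ j`. The mean second moment of the
draws for a block is the density of the disagreement of `C` and `C'` on the block, so a Chernoff
bound allows an error of `ε` times any majorant of that disagreement. The majorant used for a block
adds to its own disagreement a `1 / (2k)` share of the disagreements on the two diagonal blocks; the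
majorants of all blocks still sum to at most twice the distance of `C` and `C'`.

A union bound over all `C'` is affordable because a block only sees the restriction of `C'` to
`C_i ∪ C_j`. If `m` points of `C_i ∪ C_j` have to be relabelled to give each of the two clusters its
most frequent label, then the diagonal shares show that `|C_j| (1 + m)` is at most `4k` times the
majorant, unless the block has no disagreement and hence no error at all. So such a `C'` fails with
probability at most `2 x ^ (1 + m)`, where `x = exp (-q ε² / (16 k))`, and the sum of `x ^ m` over
all relabellings of `n` points is `(1 + (k - 1) x) ^ n`. -/

namespace CorrClust

section Chernoff

variable {Ω : Type*} {mΩ : MeasurableSpace Ω} {μ : Measure Ω}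

theorem mgf_le_exp_of_abs_le_one [IsProbabilityMeasure μ] {X : Ω → ℝ} (hX : AEMeasurable X μ)
    (hb : ∀ᵐ ω ∂μ, |X ω| ≤ 1) {t : ℝ} (ht : |t| ≤ 1) :
    mgf X μ t ≤ Real.exp (t * ∫ ω, X ω ∂μ + t ^ 2 * ∫ ω, X ω ^ 2 ∂μ) := by
  have hmem : ∀ᵐ ω ∂μ, X ω ∈ Set.Icc (-1) 1 := hb.mono fun ω hω => abs_le.1 hω
  have hint : Integrable X μ := .of_mem_Icc _ _ hX hmem
  have hint_sq : Integrable (fun ω => X ω ^ 2) μ :=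
    .of_mem_Icc 0 1 (hX.pow_const 2) (hb.mono fun ω hω =>
      ⟨sq_nonneg _, (sq_le_one_iff_abs_le_one _).2 hω⟩)
  have hexp : ∀ᵐ ω ∂μ, Real.exp (t * X ω) ≤ 1 + t * X ω + t ^ 2 * X ω ^ 2 := by
    filter_upwards [hb] with ω hω
    have htX : |t * X ω| ≤ 1 := by
      rw [abs_mul]
      exact mul_le_one₀ ht (abs_nonneg _) hω
    linarith [(abs_le.1 (Real.abs_exp_sub_one_sub_id_le htX)).2, mul_pow t (X ω) 2]
  calc mgf X μ t ≤ ∫ ω, (1 + t * X ω + t ^ 2 * X ω ^ 2) ∂μ :=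
        integral_mono_ae (integrable_exp_mul_of_mem_Icc hX hmem) (by fun_prop) hexp
    _ = t * ∫ ω, X ω ∂μ + t ^ 2 * ∫ ω, X ω ^ 2 ∂μ + 1 := by
        rw [integral_add (by fun_prop) (by fun_prop), integral_add (by fun_prop) (by fun_prop),
          integral_const_mul, integral_const_mul, integral_const, probReal_univ, one_smul]
        ring
    _ ≤ _ := Real.add_one_le_exp _

variable {ι : Type*} {X : ι → Ω → ℝ} {ε T : ℝ}

theorem measureReal_sum_ge_le_exp (hind : iIndepFun X μ) (hX : ∀ i, Measurable (X i))
    (hb : ∀ i, ∀ᵐ ω ∂μ, |X i ω| ≤ 1) (s : Finset ι) (hε : 0 ≤ ε) (hε2 : ε ≤ 2)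
    (hT : ∑ i ∈ s, ∫ ω, X i ω ^ 2 ∂μ ≤ T) :
    μ.real {ω | ∑ i ∈ s, ∫ ω, X i ω ∂μ + ε * T ≤ ∑ i ∈ s, X i ω} ≤
      Real.exp (-(ε ^ 2 * T / 4)) := by
  have := hind.isProbabilityMeasure
  have ht : |ε / 2| ≤ 1 := by
    rw [abs_of_nonneg (by positivity)]
    linarith
  have hmgf : mgf (∑ i ∈ s, X i) μ (ε / 2) ≤
      Real.exp (ε / 2 * ∑ i ∈ s, ∫ ω, X i ω ∂μ + (ε / 2) ^ 2 * T) := by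
    calc mgf (∑ i ∈ s, X i) μ (ε / 2)
        = ∏ i ∈ s, mgf (X i) μ (ε / 2) := hind.mgf_sum hX s
      _ ≤ ∏ i ∈ s, Real.exp (ε / 2 * ∫ ω, X i ω ∂μ + (ε / 2) ^ 2 * ∫ ω, X i ω ^ 2 ∂μ) :=
          Finset.prod_le_prod (fun _ _ => mgf_nonneg)
            fun i _ => mgf_le_exp_of_abs_le_one (hX i).aemeasurable (hb i) ht
      _ = Real.exp (ε / 2 * ∑ i ∈ s, ∫ ω, X i ω ∂μ +
            (ε / 2) ^ 2 * ∑ i ∈ s, ∫ ω, X i ω ^ 2 ∂μ) := by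
          rw [← Real.exp_sum, Finset.sum_add_distrib, Finset.mul_sum, Finset.mul_sum]
      _ ≤ _ := by gcongr
  have hint : Integrable (fun ω => Real.exp (ε / 2 * (∑ i ∈ s, X i) ω)) μ :=
    hind.integrable_exp_mul_sum hX fun i _ =>
      integrable_exp_mul_of_mem_Icc (hX i).aemeasurable ((hb i).mono fun ω hω => abs_le.1 hω)
  have hchernoff := measure_ge_le_exp_mul_mgf
    (∑ i ∈ s, ∫ ω, X i ω ∂μ + ε * T) (by positivity : 0 ≤ ε / 2) hint
  simp only [Finset.sum_apply] at hchernoff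
  refine hchernoff.trans ((mul_le_mul_of_nonneg_left hmgf (Real.exp_pos _).le).trans_eq ?_)
  rw [← Real.exp_add]
  ring_nf

theorem measureReal_abs_sum_sub_gt_le_exp (hind : iIndepFun X μ)
    (hX : ∀ i, Measurable (X i)) (hb : ∀ i, ∀ᵐ ω ∂μ, |X i ω| ≤ 1) (s : Finset ι)
    (hε : 0 ≤ ε) (hε2 : ε ≤ 2) (hT : ∑ i ∈ s, ∫ ω, X i ω ^ 2 ∂μ ≤ T) :
    μ.real {ω | ε * T < |∑ i ∈ s, X i ω - ∑ i ∈ s, ∫ ω, X i ω ∂μ|} ≤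
      2 * Real.exp (-(ε ^ 2 * T / 4)) := by
  have := hind.isProbabilityMeasure
  have hupper := measureReal_sum_ge_le_exp hind hX hb s hε hε2 hT
  have hlower := measureReal_sum_ge_le_exp (X := fun i ω => -X i ω)
    (hind.comp (fun _ x => -x) fun _ => measurable_neg) (fun i => (hX i).neg)
    (by simpa only [abs_neg] using hb) s hε hε2 (by simpa only [neg_sq] using hT)
  simp only [integral_neg, Finset.sum_neg_distrib] at hlower
  have hsub : {ω | ε * T < |∑ i ∈ s, X i ω - ∑ i ∈ s, ∫ ω, X i ω ∂μ|} ⊆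
      {ω | ∑ i ∈ s, ∫ ω, X i ω ∂μ + ε * T ≤ ∑ i ∈ s, X i ω} ∪
        {ω | -∑ i ∈ s, ∫ ω, X i ω ∂μ + ε * T ≤ -∑ i ∈ s, X i ω} := fun ω hω =>
    (lt_abs.1 (Set.mem_ofPred.1 hω)).imp (fun h => Set.mem_ofPred.2 (by linarith))
      fun h => Set.mem_ofPred.2 (by linarith)
  linarith [(measureReal_mono (μ := μ) hsub).trans (measureReal_union_le _ _)]

end Chernoff

theorem integral_uniformOn {Ω E : Type*} [MeasurableSpace Ω] [MeasurableSingletonClass Ω]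
    [NormedAddCommGroup E] [NormedSpace ℝ E] [CompleteSpace E] (s : Finset Ω) (f : Ω → E) :
    ∫ ω, f ω ∂uniformOn (s : Set Ω) = (s.card : ℝ)⁻¹ • ∑ ω ∈ s, f ω := by
  have hint : IntegrableOn f s Measure.count :=
    Set.biUnion_of_singleton (s : Set Ω) ▸ integrableOn_finset_iUnion.2 fun ω _ =>
      integrableOn_singleton (hx := by simp)
  rw [uniformOn, ProbabilityTheory.cond, integral_smul_measure, setIntegral_finset s hint]
  simp [Measure.count_apply_finset]

theorem sum_pow_hammingDist {ι R : Type*} [Fintype ι] [DecidableEq ι] {α : ι → Type*}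
    [∀ i, Fintype (α i)] [∀ i, DecidableEq (α i)] [CommRing R] (h : ∀ i, α i) (x : R) :
    ∑ g, x ^ hammingDist g h = ∏ i, (1 + (Fintype.card (α i) - 1) * x) := by
  have hprod (g : ∀ i, α i) : x ^ hammingDist g h = ∏ i, if g i = h i then 1 else x := by
    simp [hammingDist, Finset.prod_ite]
  have hsum (i : ι) : ∑ a, (if a = h i then 1 else x) = 1 + (Fintype.card (α i) - 1) * x := by
    rw [← Finset.add_sum_erase _ _ (Finset.mem_univ (h i)), if_pos rfl,
      Finset.sum_congr rfl fun a ha => if_neg (Finset.ne_of_mem_erase ha), Finset.sum_const,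
      Finset.card_erase_of_mem (Finset.mem_univ _), Finset.card_univ, nsmul_eq_mul,
      Nat.cast_pred (Fintype.card_pos_iff.2 ⟨h i⟩)]
  simp only [hprod, ← hsum, Finset.prod_univ_sum, Fintype.piFinset_univ]

section UpperSum

variable {ι : Type*} [Fintype ι] [LinearOrder ι] [LocallyFiniteOrderTop ι]

/-- The sum of `b` over the unordered pairs of indices, the diagonal pairs having weight `1 / 2`. -/
noncomputable def upperSum (b : ι → ι → ℝ) : ℝ :=
  (1 / 2) * ∑ i, b i i + ∑ i, ∑ j ∈ Finset.Ioi i, b i j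

theorem upperSum_eq_half_sum [LocallyFiniteOrderBot ι] {b : ι → ι → ℝ} (hb : ∀ i j, b i j = b j i) :
    upperSum b = (1 / 2) * ∑ i, ∑ j, b i j := by
  have hoff : 2 * ∑ i, ∑ j ∈ Finset.Ioi i, b i j = ∑ i, ∑ j ∈ {i}ᶜ, b i j := by
    simp only [Finset.mul_sum, two_mul]
    simpa only [hb _ _] using Finset.sum_sum_Ioi_add_eq_sum_sum_off_diag b
  simp only [upperSum, fun i => Fintype.sum_eq_add_sum_compl i (b i), Finset.sum_add_distrib,
    ← hoff]
  ring

theorem abs_upperSum_sub_le {b b' e : ι → ι → ℝ} (h : ∀ i j, i ≤ j → |b i j - b' i j| ≤ e i j) :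
    |upperSum b - upperSum b'| ≤ upperSum e := by
  have hsplit : upperSum b - upperSum b' = (1 / 2) * ∑ i, (b i i - b' i i) +
      ∑ i, ∑ j ∈ Finset.Ioi i, (b i j - b' i j) := by
    simp only [upperSum, Finset.sum_sub_distrib]
    ring
  rw [hsplit]
  refine (abs_add_le _ _).trans (add_le_add ?_ ?_)
  · rw [abs_mul, abs_of_pos one_half_pos]
    gcongr
    exact (Finset.abs_sum_le_sum_abs _ _).trans (Finset.sum_le_sum fun i _ => h i i le_rfl)
  · refine (Finset.abs_sum_le_sum_abs _ _).trans (Finset.sum_le_sum fun i _ => ?_)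
    exact (Finset.abs_sum_le_sum_abs _ _).trans
      (Finset.sum_le_sum fun j hj => h i j (Finset.mem_Ioi.1 hj).le)

end UpperSum

variable {V : Type*} {k : ℕ}

section Sampling

variable [Fintype V]

theorem mem_cluster {C : Clustering V k} {j : Fin k} {v : V} : v ∈ cluster C j ↔ C v = j := by
  simp [cluster]

/-- The indices of the draws from the cluster `j` that are made for the points of the cluster `i`:
these are the draws that estimate the block `(i, j)`. -/
def sampleIndices (C : Clustering V k) (q : ℕ) (i j : Fin k) : Finset (SampleIndex C q) :=
  {x | C x.1.1.1 = i ∧ x.1.1.2 = j}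

theorem mem_sampleIndices {C : Clustering V k} {q : ℕ} {i j : Fin k} {x : SampleIndex C q} :
    x ∈ sampleIndices C q i j ↔ C x.1.1.1 = i ∧ x.1.1.2 = j := by
  simp [sampleIndices]

theorem sum_sampleIndices {M : Type*} [AddCommMonoid M] {C : Clustering V k} {q : ℕ} (i j : Fin k)
    (φ : SampleIndex C q → M) :
    ∑ x ∈ sampleIndices C q i j, φ x =
      ∑ u ∈ cluster C i, if h : C u ≤ j ∧ (cluster C j).Nonempty then
        ∑ s, φ (⟨(u, j), h⟩, s) else 0 := by
  classical
  rw [← Finset.sum_fiberwise_of_maps_to (t := cluster C i) (g := fun x => x.1.1.1)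
    fun x hx => mem_cluster.2 (mem_sampleIndices.1 hx).1]
  refine Finset.sum_congr rfl fun u hu => ?_
  split_ifs with h
  · refine Finset.sum_bij' (fun x _ => x.2) (fun s _ => (⟨(u, j), h⟩, s)) (by simp)
      (fun s _ => Finset.mem_filter.2 ⟨mem_sampleIndices.2 ⟨mem_cluster.1 hu, rfl⟩, rfl⟩)
      ?_ (fun _ _ => rfl) ?_
    all_goals
      rintro ⟨⟨⟨u', j'⟩, _⟩, s⟩ hx
      obtain ⟨⟨-, rfl⟩, rfl⟩ := (Finset.mem_filter.1 hx).imp_left mem_sampleIndices.1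
      rfl
  · refine Finset.sum_eq_zero ?_
    rintro ⟨⟨⟨u', j'⟩, h'⟩, s⟩ hx
    obtain ⟨⟨-, rfl⟩, rfl⟩ := (Finset.mem_filter.1 hx).imp_left mem_sampleIndices.1
    exact absurd h' h

variable [MeasurableSpace V] [DiscreteMeasurableSpace V]

instance isProbabilityMeasure_uniformOn_cluster (C : Clustering V k) (q : ℕ)
    (x : SampleIndex C q) : IsProbabilityMeasure (uniformOn (cluster C x.1.1.2 : Set V)) :=
  isProbabilityMeasure_uniformOn (Finset.finite_toSet _) (Finset.coe_nonempty.2 x.1.2.2)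

theorem iIndepFun_sampleLaw (C : Clustering V k) (q : ℕ) (φ : SampleIndex C q → V → ℝ) :
    iIndepFun (fun x S => φ x (S x)) (sampleLaw C q) :=
  iIndepFun_pi fun _ => (Measurable.of_discrete).aemeasurable

theorem integral_eval_sampleLaw (C : Clustering V k) (q : ℕ) (x : SampleIndex C q) (φ : V → ℝ) :
    ∫ S, φ (S x) ∂sampleLaw C q =
      ((cluster C x.1.1.2).card : ℝ)⁻¹ * ∑ v ∈ cluster C x.1.1.2, φ v :=
  (integral_comp_eval .of_discrete).trans (integral_uniformOn _ φ)

theorem ae_sample_mem_cluster (C : Clustering V k) (q : ℕ) :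
    ∀ᵐ S ∂sampleLaw C q, ∀ x : SampleIndex C q, S x ∈ cluster C x.1.1.2 := by
  refine ae_all_iff.2 fun x => Measure.tendsto_eval_ae_ae.eventually
    (p := fun v => v ∈ cluster C x.1.1.2) ?_
  exact ae_cond_mem (Finset.measurableSet _)

end Sampling

section Blocks

variable [Fintype V]

/-- The sum of `F` over the block `(i, j)`: the pairs whose first point is in the cluster `i` and
whose second point is in the cluster `j`. -/
def blockSum (C : Clustering V k) (F : V → V → ℝ) (i j : Fin k) : ℝ :=
  ∑ u ∈ cluster C i, ∑ v ∈ cluster C j, F u v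

/-- The estimate of `blockSum C F i j` that is computed from the samples. -/
noncomputable def blockEstimate {C : Clustering V k} {q : ℕ} (S : Sample C q) (F : V → V → ℝ)
    (i j : Fin k) : ℝ :=
  (cluster C j).card / q * ∑ u ∈ cluster C i, sampleSum S u j (F u)

theorem sum_sum_eq_sum_blockSum (C : Clustering V k) (F : V → V → ℝ) :
    ∑ u, ∑ v, F u v = ∑ i, ∑ j, blockSum C F i j := by
  have hfiber (g : V → ℝ) : ∑ v, g v = ∑ i, ∑ v ∈ cluster C i, g v :=
    (Finset.sum_fiberwise Finset.univ C g).symm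
  simp only [blockSum, Finset.sum_comm (s := Finset.univ (α := Fin k)) (t := cluster C _), hfiber]

theorem blockSum_comm (C : Clustering V k) {F : V → V → ℝ} (hF : ∀ u v, F u v = F v u)
    (i j : Fin k) : blockSum C F i j = blockSum C F j i := by
  unfold blockSum
  rw [Finset.sum_comm]
  exact Finset.sum_congr rfl fun u _ => Finset.sum_congr rfl fun v _ => hF _ _

theorem blockSum_nonneg (C : Clustering V k) {F : V → V → ℝ} (hF : ∀ u v, 0 ≤ F u v)
    (i j : Fin k) : 0 ≤ blockSum C F i j :=
  Finset.sum_nonneg fun _ _ => Finset.sum_nonneg fun _ _ => hF _ _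

theorem blockSum_congr {C : Clustering V k} {F F' : V → V → ℝ} {i j : Fin k}
    (h : ∀ u ∈ cluster C i, ∀ v ∈ cluster C j, F u v = F' u v) :
    blockSum C F i j = blockSum C F' i j :=
  Finset.sum_congr rfl fun u hu => Finset.sum_congr rfl fun v hv => h u hu v hv

theorem blockEstimate_eq_sum_sampleIndices {C : Clustering V k} {q : ℕ} (S : Sample C q)
    (F : V → V → ℝ) (i j : Fin k) :
    blockEstimate S F i j =
      (cluster C j).card / q * ∑ x ∈ sampleIndices C q i j, F x.1.1.1 (S x) := by
  rw [sum_sampleIndices]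
  rfl

theorem blockEstimate_congr {C : Clustering V k} {q : ℕ} {S : Sample C q}
    (hS : ∀ x : SampleIndex C q, S x ∈ cluster C x.1.1.2) {F F' : V → V → ℝ} {i j : Fin k}
    (h : ∀ u ∈ cluster C i, ∀ v ∈ cluster C j, F u v = F' u v) :
    blockEstimate S F i j = blockEstimate S F' i j := by
  simp only [blockEstimate_eq_sum_sampleIndices]
  congr 1
  refine Finset.sum_congr rfl fun x hx => ?_
  obtain ⟨hi, hj⟩ := mem_sampleIndices.1 hx
  exact h _ (mem_cluster.2 hi) _ (hj ▸ hS x)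

variable [MeasurableSpace V] [DiscreteMeasurableSpace V]

theorem sum_integral_sampleIndices (C : Clustering V k) (q : ℕ) (F : V → V → ℝ) {i j : Fin k}
    (hij : i ≤ j) (hj : (cluster C j).Nonempty) :
    ∑ x ∈ sampleIndices C q i j, ∫ S, F x.1.1.1 (S x) ∂sampleLaw C q =
      q / (cluster C j).card * blockSum C F i j := by
  rw [sum_sampleIndices, blockSum, Finset.mul_sum]
  refine Finset.sum_congr rfl fun u hu => ?_
  rw [dif_pos ⟨(mem_cluster.1 hu).trans_le hij, hj⟩]
  simp only [integral_eval_sampleLaw C q _ (F u), Finset.sum_const, Finset.card_univ,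
    Fintype.card_fin, nsmul_eq_mul, div_eq_mul_inv, mul_assoc]

theorem measureReal_blockEstimate_deviation_le (C : Clustering V k) (q : ℕ) {F : V → V → ℝ}
    (hF : ∀ u v, |F u v| ≤ 1) {i j : Fin k} (hij : i ≤ j) (hj : (cluster C j).Nonempty)
    {ε : ℝ} (hε : 0 ≤ ε) (hε2 : ε ≤ 2) {T : ℝ} (hT : blockSum C (fun u v => F u v ^ 2) i j ≤ T) :
    (sampleLaw C q).real {S | ε * T < |blockEstimate S F i j - blockSum C F i j|} ≤
      2 * Real.exp (-(ε ^ 2 * (q / (cluster C j).card * T) / 4)) := by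
  rcases q.eq_zero_or_pos with rfl | hq
  · have := measureReal_le_one (μ := sampleLaw C 0)
      (s := {S | ε * T < |blockEstimate S F i j - blockSum C F i j|})
    norm_num
    linarith
  have hscale : (0 : ℝ) < q / (cluster C j).card :=
    div_pos (by exact_mod_cast hq) (by exact_mod_cast hj.card_pos)
  have hmean := sum_integral_sampleIndices C q F hij hj
  have hvar : ∑ x ∈ sampleIndices C q i j, ∫ S, F x.1.1.1 (S x) ^ 2 ∂sampleLaw C q ≤
      q / (cluster C j).card * T := by
    rw [sum_integral_sampleIndices C q (fun u v => F u v ^ 2) hij hj]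
    gcongr
  have hdev := measureReal_abs_sum_sub_gt_le_exp
    (iIndepFun_sampleLaw C q fun x => F x.1.1.1) (fun _ => .of_discrete)
    (fun _ => .of_forall fun _ => hF _ _) (sampleIndices C q i j) hε hε2 hvar
  rw [hmean] at hdev
  refine (measureReal_mono fun S hS => ?_).trans hdev
  have hestimate : ∑ x ∈ sampleIndices C q i j, F x.1.1.1 (S x) =
      q / (cluster C j).card * blockEstimate S F i j := by
    rw [blockEstimate_eq_sum_sampleIndices, ← inv_div (q : ℝ), mul_inv_cancel_left₀ hscale.ne']
  rw [Set.mem_ofPred, hestimate, ← mul_sub, abs_mul, abs_of_pos hscale, mul_left_comm]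
  exact mul_lt_mul_of_pos_left hS hscale

end Blocks

section Disagreement

/-- The indicator that the pivot `C` and `C'` disagree on the pair `u, v`: the distance of
the clusterings is its sum over the unordered pairs. -/
def disagreement (C C' : Clustering V k) (u v : V) : ℝ :=
  if C u = C v ↔ C' u = C' v then 0 else 1

theorem disagreement_comm (C C' : Clustering V k) (u v : V) :
    disagreement C C' u v = disagreement C C' v u := by
  simp only [disagreement, eq_comm (a := C u), eq_comm (a := C' u)]

theorem disagreement_nonneg (C C' : Clustering V k) (u v : V) : 0 ≤ disagreement C C' u v := by
  unfold disagreement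
  split_ifs <;> norm_num

theorem disagreement_congr {C C' C'' : Clustering V k} {u v : V} (hu : C' u = C'' u)
    (hv : C' v = C'' v) : disagreement C C' u v = disagreement C C'' u v := by
  simp only [disagreement, hu, hv]

variable (G : SimpleGraph V) [DecidableRel G.Adj]

theorem pairRegret_comm (C C' : Clustering V k) (u v : V) :
    pairRegret G C C' u v = pairRegret G C C' v u := by
  simp only [pairRegret, pairCost, G.adj_comm u v, eq_comm (a := C u), eq_comm (a := C' u)]

theorem pairRegret_sq (C C' : Clustering V k) (u v : V) :
    pairRegret G C C' u v ^ 2 = disagreement C C' u v := by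
  by_cases hG : G.Adj u v <;> by_cases h : C u = C v <;> by_cases h' : C' u = C' v <;>
    simp [pairRegret, pairCost, disagreement, hG, h, h']

theorem abs_pairRegret_le_one (C C' : Clustering V k) (u v : V) :
    |pairRegret G C C' u v| ≤ 1 := by
  rw [← sq_le_one_iff_abs_le_one, pairRegret_sq, disagreement]
  split_ifs <;> norm_num

theorem pairRegret_congr {C C' C'' : Clustering V k} {u v : V} (hu : C' u = C'' u)
    (hv : C' v = C'' v) : pairRegret G C C' u v = pairRegret G C C'' u v := by
  simp only [pairRegret, pairCost, hu, hv]

variable [Fintype V]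

theorem regret_eq_upperSum [DecidableEq V] (C C' : Clustering V k) :
    regret G C C' = upperSum (blockSum C (pairRegret G C C')) := by
  have hdiag (u : V) : pairRegret G C C' u u = 0 := by simp [pairRegret, pairCost]
  rw [upperSum_eq_half_sum (blockSum_comm C (pairRegret_comm G C C')), ← sum_sum_eq_sum_blockSum,
    regret, cost, cost, ← mul_sub, ← Finset.sum_sub_distrib]
  congr! 2 with u
  rw [← Finset.sum_sub_distrib]
  exact Finset.sum_filter_of_ne fun v _ hv => fun h => hv (h ▸ hdiag u)

theorem estimator_eq_upperSum {C : Clustering V k} {q : ℕ} (S : Sample C q)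
    (C' : Clustering V k) :
    estimator G C S C' = upperSum (blockEstimate S (pairRegret G C C')) := by
  simp only [estimator, upperSum, blockEstimate, Finset.mul_sum, Finset.sum_comm (s := cluster C _)]

theorem dist_eq_upperSum (C C' : Clustering V k) :
    dist C C' = upperSum (blockSum C (disagreement C C')) := by
  rw [upperSum_eq_half_sum (blockSum_comm C (disagreement_comm C C')), ← sum_sum_eq_sum_blockSum]
  unfold dist
  congr! 3 with u _ v
  by_cases h : C u = C v <;> by_cases h' : C' u = C' v <;> simp [disagreement, h, h']

theorem dist_nonneg (C C' : Clustering V k) : 0 ≤ dist C C' := by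
  unfold dist
  positivity

end Disagreement

section BlockMajorant

variable [Fintype V]

/-- The disagreement on the block `(i, j)`, enlarged by a share of the disagreements on the two
diagonal blocks. The factor `1 / (2 * k)` is small enough for the majorants of all blocks to add up
to a multiple of the distance of the clusterings. -/
noncomputable def blockMajorant (C C' : Clustering V k) (i j : Fin k) : ℝ :=
  blockSum C (disagreement C C') i j +
    (blockSum C (disagreement C C') i i + blockSum C (disagreement C C') j j) / (2 * k)

theorem blockSum_disagreement_nonneg (C C' : Clustering V k) (i j : Fin k) :
    0 ≤ blockSum C (disagreement C C') i j :=
  blockSum_nonneg C (disagreement_nonneg C C') i j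

theorem blockSum_disagreement_le_blockMajorant (C C' : Clustering V k) (i j : Fin k) :
    blockSum C (disagreement C C') i j ≤ blockMajorant C C' i j :=
  le_add_of_nonneg_right (div_nonneg (add_nonneg (blockSum_disagreement_nonneg C C' i i)
    (blockSum_disagreement_nonneg C C' j j)) (by positivity))

theorem blockMajorant_nonneg (C C' : Clustering V k) (i j : Fin k) : 0 ≤ blockMajorant C C' i j :=
  (blockSum_disagreement_nonneg C C' i j).trans (blockSum_disagreement_le_blockMajorant C C' i j)

theorem add_diagonal_le_blockMajorant (C C' : Clustering V k) (i j : Fin k) :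
    blockSum C (disagreement C C') i i + blockSum C (disagreement C C') j j ≤
      2 * k * blockMajorant C C' i j := by
  have hk : (0 : ℝ) < k := by exact_mod_cast i.pos
  rw [blockMajorant, mul_add, mul_div_cancel₀ _ (by positivity)]
  have := blockSum_disagreement_nonneg C C' i j
  exact le_add_of_nonneg_left (by positivity)

theorem blockMajorant_congr {C C' C'' : Clustering V k} {i j : Fin k}
    (h : ∀ v, C v = i ∨ C v = j → C' v = C'' v) :
    blockMajorant C C' i j = blockMajorant C C'' i j := by
  have hblock {i' j' : Fin k} (hi : i' = i ∨ i' = j) (hj : j' = i ∨ j' = j) :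
      blockSum C (disagreement C C') i' j' = blockSum C (disagreement C C'') i' j' :=
    blockSum_congr fun u hu v hv => disagreement_congr
      (h u ((mem_cluster.1 hu).symm ▸ hi)) (h v ((mem_cluster.1 hv).symm ▸ hj))
  simp only [blockMajorant, hblock (.inl rfl) (.inr rfl), hblock (.inl rfl) (.inl rfl),
    hblock (.inr rfl) (.inr rfl)]

theorem upperSum_blockMajorant_le (C C' : Clustering V k) :
    upperSum (blockMajorant C C') ≤ 2 * dist C C' := by
  have hD := blockSum_comm C (disagreement_comm C C')
  have hM (i j : Fin k) : blockMajorant C C' i j = blockMajorant C C' j i := by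
    rw [blockMajorant, blockMajorant, hD i j, add_comm (blockSum C _ i i)]
  have hdiag : ∑ i, blockSum C (disagreement C C') i i ≤
      ∑ i, ∑ j, blockSum C (disagreement C C') i j :=
    Finset.sum_le_sum fun i _ => Finset.single_le_sum
      (fun j _ => blockSum_disagreement_nonneg C C' i j) (Finset.mem_univ i)
  have hsum : ∑ i, ∑ j, blockMajorant C C' i j =
      ∑ i, ∑ j, blockSum C (disagreement C C') i j + ∑ i, blockSum C (disagreement C C') i i := by
    rcases k.eq_zero_or_pos with rfl | hk
    · simp
    · simp only [blockMajorant, Finset.sum_add_distrib, ← Finset.sum_div, Finset.sum_const,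
        Finset.card_univ, Fintype.card_fin, nsmul_eq_mul, ← Finset.mul_sum]
      field_simp
      ring
  rw [dist_eq_upperSum, upperSum_eq_half_sum hD, upperSum_eq_half_sum hM, hsum]
  linarith

theorem abs_regret_sub_estimator_le [DecidableEq V] (G : SimpleGraph V) [DecidableRel G.Adj]
    {C C' : Clustering V k} {q : ℕ} {S : Sample C q} {ε : ℝ} (hε : 0 ≤ ε)
    (h : ∀ i j, i ≤ j → (cluster C j).Nonempty →
      |blockEstimate S (pairRegret G C C') i j - blockSum C (pairRegret G C C') i j| ≤
        ε * blockMajorant C C' i j) :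
    |regret G C C' - estimator G C S C'| ≤ 2 * ε * dist C C' := by
  have hblock (i j : Fin k) (hij : i ≤ j) :
      |blockSum C (pairRegret G C C') i j - blockEstimate S (pairRegret G C C') i j| ≤
        ε * blockMajorant C C' i j := by
    rcases (cluster C j).eq_empty_or_nonempty with hj | hj
    · simpa [blockSum, blockEstimate, hj] using mul_nonneg hε (blockMajorant_nonneg C C' i j)
    · exact abs_sub_comm (blockSum C _ i j) _ ▸ h i j hij hj
  calc |regret G C C' - estimator G C S C'|
      ≤ upperSum fun i j => ε * blockMajorant C C' i j := by
        rw [regret_eq_upperSum, estimator_eq_upperSum]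
        exact abs_upperSum_sub_le hblock
    _ = ε * upperSum (blockMajorant C C') := by
        simp only [upperSum, mul_add, Finset.mul_sum, mul_left_comm ε]
    _ ≤ ε * (2 * dist C C') := mul_le_mul_of_nonneg_left (upperSum_blockMajorant_le C C') hε
    _ = 2 * ε * dist C C' := by ring

end BlockMajorant

section Localization

variable [Fintype V]

theorem exists_card_mul_card_ne_le_blockSum (C C' : Clustering V k) (i : Fin k) :
    ∃ l, ((cluster C i).card : ℝ) * ((cluster C i).filter (C' · ≠ l)).card ≤
      blockSum C (disagreement C C') i i := by
  obtain ⟨l, -, hmin⟩ := Finset.exists_min_image Finset.univ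
    (fun l => ((cluster C i).filter (C' · ≠ l)).card) ⟨i, Finset.mem_univ i⟩
  refine ⟨l, ?_⟩
  rw [blockSum, ← nsmul_eq_mul, ← Finset.sum_const]
  refine Finset.sum_le_sum fun u hu => ?_
  have hrow : ∑ v ∈ cluster C i, disagreement C C' u v =
      ((cluster C i).filter (C' · ≠ C' u)).card := by
    rw [Finset.card_filter, Nat.cast_sum]
    refine Finset.sum_congr rfl fun v hv => ?_
    simp [disagreement, mem_cluster.1 hu, mem_cluster.1 hv, eq_comm (a := C' u)]
  rw [hrow]
  exact_mod_cast hmin (C' u) (Finset.mem_univ _)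

theorem blockSum_disagreement_of_forall_eq {C C' : Clustering V k} {i j a b : Fin k}
    (ha : ∀ v ∈ cluster C i, C' v = a) (hb : ∀ v ∈ cluster C j, C' v = b) :
    blockSum C (disagreement C C') i j =
      if i = j ↔ a = b then 0 else ((cluster C i).card * (cluster C j).card : ℝ) := by
  have hconst : blockSum C (disagreement C C') i j =
      blockSum C (fun _ _ => if i = j ↔ a = b then 0 else 1) i j :=
    blockSum_congr fun u hu v hv => by
      rw [disagreement, mem_cluster.1 hu, mem_cluster.1 hv, ha u hu, hb v hv]
  rw [hconst]
  split_ifs <;> simp [blockSum]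

theorem card_le_blockSum_disagreement {C C' : Clustering V k} {i j a b : Fin k}
    (ha : ∀ v ∈ cluster C i, C' v = a) (hb : ∀ v ∈ cluster C j, C' v = b)
    (hpos : 0 < blockSum C (disagreement C C') i j) :
    (cluster C j).card ≤ blockSum C (disagreement C C') i j := by
  rw [blockSum_disagreement_of_forall_eq ha hb] at hpos ⊢
  split_ifs at hpos ⊢
  · exact absurd hpos (lt_irrefl 0)
  · refine le_mul_of_one_le_left (Nat.cast_nonneg _) ?_
    exact_mod_cast Nat.pos_of_ne_zero fun h => by simp [h] at hpos

/-- The clustering that gives the label `a` to the cluster `i` of `C` and the label `b` to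
everything else: up to few changes, only such clusterings have to be considered on a block. -/
def twoLabel (C : Clustering V k) (i a b : Fin k) : Clustering V k :=
  fun v => if C v = i then a else b

/-- The clustering that agrees with `C'` on the clusters `i` and `j` of `C` and gives the label `b`
to everything else: it has the same block `(i, j)` as `C'`. -/
def relabelOutside (C C' : Clustering V k) (i j b : Fin k) : Clustering V k :=
  fun v => if C v = i ∨ C v = j then C' v else b

theorem hammingDist_relabelOutside_twoLabel_le (C C' : Clustering V k) (i j a b : Fin k) :
    hammingDist (relabelOutside C C' i j b) (twoLabel C i a b) ≤
      ((cluster C i).filter (C' · ≠ a)).card + ((cluster C j).filter (C' · ≠ b)).card := by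
  classical
  refine (Finset.card_le_card fun v hv => ?_).trans (Finset.card_union_le _ _)
  have hne : relabelOutside C C' i j b v ≠ twoLabel C i a b v := (Finset.mem_filter.1 hv).2
  simp only [Finset.mem_union, Finset.mem_filter, mem_cluster]
  grind [relabelOutside, twoLabel]

theorem exists_card_mul_hammingDist_le_blockMajorant {C C' : Clustering V k} {i j : Fin k}
    (hcard : (cluster C j).card ≤ (cluster C i).card)
    (hpos : 0 < blockSum C (disagreement C C') i j) :
    ∃ a b, ((cluster C j).card : ℝ) *
      (1 + hammingDist (relabelOutside C C' i j b) (twoLabel C i a b)) ≤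
        4 * k * blockMajorant C C' i j := by
  obtain ⟨a, ha⟩ := exists_card_mul_card_ne_le_blockSum C C' i
  obtain ⟨b, hb⟩ := exists_card_mul_card_ne_le_blockSum C C' j
  refine ⟨a, b, ?_⟩
  set m := ((cluster C i).filter (C' · ≠ a)).card + ((cluster C j).filter (C' · ≠ b)).card with hm
  have hmoved : ((cluster C j).card : ℝ) * m ≤ 2 * k * blockMajorant C C' i j := calc
    ((cluster C j).card : ℝ) * m
      = (cluster C j).card * ((cluster C i).filter (C' · ≠ a)).card +
          (cluster C j).card * ((cluster C j).filter (C' · ≠ b)).card := by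
        rw [hm, Nat.cast_add, mul_add]
    _ ≤ (cluster C i).card * ((cluster C i).filter (C' · ≠ a)).card +
          (cluster C j).card * ((cluster C j).filter (C' · ≠ b)).card := by gcongr
    _ ≤ _ := (add_le_add ha hb).trans (add_diagonal_le_blockMajorant C C' i j)
  have hbase : ((cluster C j).card : ℝ) ≤ 2 * k * blockMajorant C C' i j := by
    rcases m.eq_zero_or_pos with h0 | h1
    · obtain ⟨hi, hj⟩ := Nat.add_eq_zero_iff.1 h0
      simp only [Finset.card_eq_zero, Finset.filter_eq_empty_iff, not_not] at hi hj
      have hk : (1 : ℝ) ≤ k := by exact_mod_cast i.pos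
      calc ((cluster C j).card : ℝ)
          ≤ blockSum C (disagreement C C') i j := card_le_blockSum_disagreement hi hj hpos
        _ ≤ blockMajorant C C' i j := blockSum_disagreement_le_blockMajorant C C' i j
        _ ≤ 2 * k * blockMajorant C C' i j :=
          le_mul_of_one_le_left (blockMajorant_nonneg C C' i j) (by linarith)
    · exact (le_mul_of_one_le_right (Nat.cast_nonneg _) (by exact_mod_cast h1)).trans hmoved
  calc ((cluster C j).card : ℝ) *
        (1 + hammingDist (relabelOutside C C' i j b) (twoLabel C i a b))
      ≤ (cluster C j).card * (1 + m) := by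
        gcongr
        exact hammingDist_relabelOutside_twoLabel_le C C' i j a b
    _ ≤ 4 * k * blockMajorant C C' i j := by linarith

end Localization

section UnionBound

variable [Fintype V] (G : SimpleGraph V) [DecidableRel G.Adj]

/-- The samples whose estimate of the block `(i, j)` of the regret of `C'` is off by more than `ε`
times the majorant of the block. -/
def blockFailure (C : Clustering V k) (q : ℕ) (ε : ℝ) (i j : Fin k) (C' : Clustering V k) :
    Set (Sample C q) :=
  {S | ε * blockMajorant C C' i j <
    |blockEstimate S (pairRegret G C C') i j - blockSum C (pairRegret G C C') i j|}

variable {G} {C C' : Clustering V k} {q : ℕ} {ε : ℝ} {i j : Fin k}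

theorem mem_blockFailure_congr {C'' : Clustering V k} {S : Sample C q}
    (hS : ∀ x : SampleIndex C q, S x ∈ cluster C x.1.1.2)
    (h : ∀ v, C v = i ∨ C v = j → C' v = C'' v) :
    S ∈ blockFailure G C q ε i j C' ↔ S ∈ blockFailure G C q ε i j C'' := by
  have hregret : ∀ u ∈ cluster C i, ∀ v ∈ cluster C j,
      pairRegret G C C' u v = pairRegret G C C'' u v := fun u hu v hv =>
    pairRegret_congr G (h u (.inl (mem_cluster.1 hu))) (h v (.inr (mem_cluster.1 hv)))
  rw [blockFailure, blockFailure, Set.mem_ofPred, Set.mem_ofPred, blockMajorant_congr h,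
    blockSum_congr hregret, blockEstimate_congr hS hregret]

theorem blockSum_disagreement_pos_of_mem_blockFailure {S : Sample C q}
    (hS : ∀ x : SampleIndex C q, S x ∈ cluster C x.1.1.2) (hε : 0 ≤ ε)
    (hfail : S ∈ blockFailure G C q ε i j C') : 0 < blockSum C (disagreement C C') i j := by
  refine (blockSum_disagreement_nonneg C C' i j).lt_of_ne' fun hzero => ?_
  have hregret : ∀ u ∈ cluster C i, ∀ v ∈ cluster C j, pairRegret G C C' u v = 0 := by
    intro u hu v hv
    have hrow := (Finset.sum_eq_zero_iff_of_nonneg fun u _ =>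
      Finset.sum_nonneg fun v _ => disagreement_nonneg C C' u v).1 hzero u hu
    rw [← sq_eq_zero_iff, pairRegret_sq]
    exact (Finset.sum_eq_zero_iff_of_nonneg fun v _ => disagreement_nonneg C C' u v).1 hrow v hv
  rw [blockFailure, Set.mem_ofPred, blockSum_congr (F' := 0) hregret,
    blockEstimate_congr hS (F' := 0) hregret] at hfail
  simp only [blockSum, blockEstimate_eq_sum_sampleIndices, Pi.zero_apply, Finset.sum_const_zero,
    mul_zero, sub_zero, abs_zero] at hfail
  exact hfail.not_ge (mul_nonneg hε (blockMajorant_nonneg C C' i j))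

theorem exists_mem_blockFailure_hammingDist_le {S : Sample C q}
    (hS : ∀ x : SampleIndex C q, S x ∈ cluster C x.1.1.2) (hε : 0 ≤ ε)
    (hcard : (cluster C j).card ≤ (cluster C i).card)
    (hfail : S ∈ blockFailure G C q ε i j C') :
    ∃ a b g, S ∈ blockFailure G C q ε i j g ∧
      ((cluster C j).card : ℝ) * (1 + hammingDist g (twoLabel C i a b)) ≤
        4 * k * blockMajorant C g i j := by
  obtain ⟨a, b, hab⟩ := exists_card_mul_hammingDist_le_blockMajorant hcard
    (blockSum_disagreement_pos_of_mem_blockFailure hS hε hfail)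
  have hagree (v : V) (hv : C v = i ∨ C v = j) : C' v = relabelOutside C C' i j b v :=
    (if_pos hv).symm
  exact ⟨a, b, relabelOutside C C' i j b, (mem_blockFailure_congr hS hagree).1 hfail,
    blockMajorant_congr hagree ▸ hab⟩

variable [MeasurableSpace V] [DiscreteMeasurableSpace V]

theorem measureReal_blockFailure_le (hε : 0 ≤ ε) (hε2 : ε ≤ 2) (hij : i ≤ j)
    (hj : (cluster C j).Nonempty) {m : ℕ}
    (hm : ((cluster C j).card : ℝ) * (1 + m) ≤ 4 * k * blockMajorant C C' i j) :
    (sampleLaw C q).real (blockFailure G C q ε i j C') ≤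
      2 * Real.exp (-(q * ε ^ 2 / (16 * k))) ^ (1 + m) := by
  have hk : (0 : ℝ) < k := by exact_mod_cast i.pos
  have hcard : (0 : ℝ) < (cluster C j).card := by exact_mod_cast hj.card_pos
  have hvar : blockSum C (fun u v => pairRegret G C C' u v ^ 2) i j ≤ blockMajorant C C' i j := by
    simpa only [pairRegret_sq] using blockSum_disagreement_le_blockMajorant C C' i j
  refine (measureReal_blockEstimate_deviation_le C q (abs_pairRegret_le_one G C C') hij hj hε hε2
    hvar).trans (mul_le_mul_of_nonneg_left ?_ zero_le_two)
  rw [← Real.exp_nat_mul, Real.exp_le_exp, mul_neg, neg_le_neg_iff]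
  have hratio : (1 + m) / (4 * k) ≤ blockMajorant C C' i j / (cluster C j).card := by
    rw [div_le_div_iff₀ (by positivity) hcard]
    linarith
  calc ((1 + m : ℕ) : ℝ) * (q * ε ^ 2 / (16 * k))
      = q * ε ^ 2 / 4 * ((1 + m) / (4 * k)) := by
        push_cast
        field_simp
        ring
    _ ≤ q * ε ^ 2 / 4 * (blockMajorant C C' i j / (cluster C j).card) := by gcongr
    _ = _ := by ring

theorem measureReal_biUnion_blockFailure_le (hε : 0 ≤ ε) (hε2 : ε ≤ 2) (hij : i ≤ j)
    (hj : (cluster C j).Nonempty) (h : Clustering V k) {s : Finset (Clustering V k)}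
    (hs : ∀ g ∈ s, ((cluster C j).card : ℝ) * (1 + hammingDist g h) ≤
      4 * k * blockMajorant C g i j) :
    (sampleLaw C q).real (⋃ g ∈ s, blockFailure G C q ε i j g) ≤
      2 * Real.exp (-(q * ε ^ 2 / (16 * k))) *
        (1 + k * Real.exp (-(q * ε ^ 2 / (16 * k)))) ^ Fintype.card V := by
  classical
  set x := Real.exp (-(q * ε ^ 2 / (16 * k)))
  have hk : (1 : ℝ) ≤ k := by exact_mod_cast i.pos
  have hkx : 0 ≤ (k - 1) * x := mul_nonneg (sub_nonneg.2 hk) (Real.exp_pos _).le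
  calc (sampleLaw C q).real (⋃ g ∈ s, blockFailure G C q ε i j g)
      ≤ ∑ g ∈ s, (sampleLaw C q).real (blockFailure G C q ε i j g) :=
        measureReal_biUnion_finset_le _ _
    _ ≤ ∑ g ∈ s, 2 * x ^ (1 + hammingDist g h) := Finset.sum_le_sum fun g hg =>
        measureReal_blockFailure_le hε hε2 hij hj (hs g hg)
    _ ≤ ∑ g, 2 * x ^ (1 + hammingDist g h) :=
        Finset.sum_le_univ_sum_of_nonneg fun _ => by positivity
    _ = 2 * x * (1 + (k - 1) * x) ^ Fintype.card V := by
        simp only [pow_add, pow_one, ← mul_assoc, ← Finset.mul_sum, sum_pow_hammingDist,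
          Fintype.card_fin, Finset.prod_const, Finset.card_univ]
    _ ≤ 2 * x * (1 + k * x) ^ Fintype.card V := by
        refine mul_le_mul_of_nonneg_left
          (pow_le_pow_left₀ (add_nonneg zero_le_one hkx) ?_ _) (by positivity)
        gcongr
        exact sub_le_self _ zero_le_one

theorem measureReal_iUnion_blockFailure_le (hcard : (cluster C j).card ≤ (cluster C i).card)
    (hε : 0 ≤ ε) (hε2 : ε ≤ 2) (hij : i ≤ j) (hj : (cluster C j).Nonempty) :
    (sampleLaw C q).real (⋃ C', blockFailure G C q ε i j C') ≤
      k ^ 2 * (2 * Real.exp (-(q * ε ^ 2 / (16 * k))) *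
        (1 + k * Real.exp (-(q * ε ^ 2 / (16 * k)))) ^ Fintype.card V) := by
  classical
  let near (p : Fin k × Fin k) : Finset (Clustering V k) :=
    {g | ((cluster C j).card : ℝ) * (1 + hammingDist g (twoLabel C i p.1 p.2)) ≤
      4 * k * blockMajorant C g i j}
  have hcover : (⋃ C', blockFailure G C q ε i j C') ≤ᵐ[sampleLaw C q]
      (⋃ p, ⋃ g ∈ near p, blockFailure G C q ε i j g : Set (Sample C q)) := by
    filter_upwards [ae_sample_mem_cluster C q] with S hS hfail
    obtain ⟨C', hC'⟩ := Set.mem_iUnion.1 hfail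
    obtain ⟨a, b, g, hg, hdist⟩ := exists_mem_blockFailure_hammingDist_le hS hε hcard hC'
    exact Set.mem_iUnion.2 ⟨(a, b), Set.mem_iUnion₂.2
      ⟨g, Finset.mem_filter.2 ⟨Finset.mem_univ g, hdist⟩, hg⟩⟩
  calc (sampleLaw C q).real (⋃ C', blockFailure G C q ε i j C')
      ≤ (sampleLaw C q).real (⋃ p, ⋃ g ∈ near p, blockFailure G C q ε i j g) :=
        ENNReal.toReal_mono (measure_ne_top _ _) (measure_mono_ae hcover)
    _ ≤ ∑ p, (sampleLaw C q).real (⋃ g ∈ near p, blockFailure G C q ε i j g) :=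
        measureReal_iUnion_fintype_le _
    _ ≤ ∑ _p : Fin k × Fin k, _ := Finset.sum_le_sum fun p _ =>
        measureReal_biUnion_blockFailure_le hε hε2 hij hj (twoLabel C i p.1 p.2)
          fun g hg => (Finset.mem_filter.1 hg).2
    _ = _ := by
        rw [Finset.sum_const, Finset.card_univ, Fintype.card_prod, Fintype.card_fin, nsmul_eq_mul,
          Nat.cast_mul, ← sq]

theorem measureReal_not_isSmoothRegretApprox_le [DecidableEq V]
    (hC : Antitone fun j : Fin k => (cluster C j).card) (hε : 0 ≤ ε) (hε2 : ε ≤ 2) :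
    (sampleLaw C q).real {S | ¬IsSmoothRegretApprox G (2 * ε) C (estimator G C S)} ≤
      k ^ 4 * (2 * Real.exp (-(q * ε ^ 2 / (16 * k))) *
        (1 + k * Real.exp (-(q * ε ^ 2 / (16 * k)))) ^ Fintype.card V) := by
  set B := 2 * Real.exp (-(q * ε ^ 2 / (16 * k))) *
    (1 + k * Real.exp (-(q * ε ^ 2 / (16 * k)))) ^ Fintype.card V
  let blocks : Finset (Fin k × Fin k) := {p | p.1 ≤ p.2 ∧ (cluster C p.2).Nonempty}
  have hcover : {S | ¬IsSmoothRegretApprox G (2 * ε) C (estimator G C S)} ⊆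
      ⋃ p ∈ blocks, ⋃ C', blockFailure G C q ε p.1 p.2 C' := by
    refine fun S hS => by_contra fun hgood => hS fun C' =>
      abs_regret_sub_estimator_le G hε fun i j hij hj => ?_
    by_contra! hfail
    exact hgood (Set.mem_iUnion₂.2 ⟨(i, j), by simpa [blocks] using ⟨hij, hj⟩,
      Set.mem_iUnion.2 ⟨C', hfail⟩⟩)
  calc _ ≤ (sampleLaw C q).real (⋃ p ∈ blocks, ⋃ C', blockFailure G C q ε p.1 p.2 C') :=
        measureReal_mono hcover (measure_ne_top _ _)
    _ ≤ ∑ p ∈ blocks, (sampleLaw C q).real (⋃ C', blockFailure G C q ε p.1 p.2 C') :=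
        measureReal_biUnion_finset_le _ _
    _ ≤ ∑ p ∈ blocks, k ^ 2 * B := by
        refine Finset.sum_le_sum fun p hp => ?_
        obtain ⟨hle, hne⟩ := (Finset.mem_filter.1 hp).2
        exact measureReal_iUnion_blockFailure_le (hC hle) hε hε2 hle hne
    _ ≤ ∑ _p : Fin k × Fin k, k ^ 2 * B :=
        Finset.sum_le_univ_sum_of_nonneg fun _ => by positivity
    _ = k ^ 4 * B := by
        simp only [Finset.sum_const, Finset.card_univ, Fintype.card_prod, Fintype.card_fin,
          nsmul_eq_mul, Nat.cast_mul]
        ring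

end UnionBound

section SampleSize

theorem pow_four_mul_le_inv_cube {n k : ℕ} (hn : 1 ≤ n) (hk : 1 ≤ k) {x : ℝ} (hx : 0 ≤ x)
    (hxle : x ≤ ((2 * n * k : ℝ) ^ 4)⁻¹) :
    k ^ 4 * (2 * x * (1 + k * x) ^ n) ≤ ((n : ℝ) ^ 3)⁻¹ := by
  have hn1 : (1 : ℝ) ≤ n := by exact_mod_cast hn
  have hk1 : (1 : ℝ) ≤ k := by exact_mod_cast hk
  have hnk1 : (1 : ℝ) ≤ n * k := one_le_mul_of_one_le_of_one_le hn1 hk1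
  have hpow : (1 + k * x) ^ n ≤ 2 := by
    have hsmall : n * (k * x) ≤ 1 / 2 := calc
      n * (k * x) ≤ n * (k * ((2 * n * k : ℝ) ^ 4)⁻¹) := by gcongr
      _ = (16 * (n * k : ℝ) ^ 3)⁻¹ := by field_simp; norm_num
      _ ≤ (2 : ℝ)⁻¹ := inv_anti₀ two_pos (by linarith [one_le_pow₀ hnk1 (n := 3)])
      _ = 1 / 2 := inv_eq_one_div 2
    calc (1 + k * x) ^ n ≤ Real.exp (k * x) ^ n := by
          gcongr
          linarith [Real.add_one_le_exp (k * x)]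
      _ = Real.exp (n * (k * x)) := (Real.exp_nat_mul _ _).symm
      _ ≤ 1 / (1 - n * (k * x)) :=
          Real.exp_bound_div_one_sub_of_interval (by positivity) (by linarith)
      _ ≤ 2 := (div_le_iff₀ (by linarith)).2 (by linarith)
  calc k ^ 4 * (2 * x * (1 + k * x) ^ n)
      ≤ k ^ 4 * (2 * ((2 * n * k : ℝ) ^ 4)⁻¹ * 2) := by gcongr
    _ = (4 * (n : ℝ) ^ 4)⁻¹ := by field_simp; norm_num
    _ ≤ ((n : ℝ) ^ 3)⁻¹ := by
        gcongr
        nlinarith [pow_pos (zero_lt_one.trans_le hn1) 3]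

theorem log_two_mul_mul_le {n k : ℕ} (hn : 2 ≤ n) (hk : 1 ≤ k) :
    Real.log (2 * n * k) ≤ 2 * k * Real.log n := by
  have hk1 : (1 : ℝ) ≤ k := by exact_mod_cast hk
  have hlog : Real.log 2 ≤ Real.log n := Real.log_le_log two_pos (by exact_mod_cast hn)
  have hlogk : Real.log k ≤ k - 1 := Real.log_le_sub_one_of_pos (by linarith)
  have hhalf : 1 / 2 ≤ Real.log n := by linarith [Real.log_two_gt_d9]
  rw [Real.log_mul (by positivity) (by positivity), Real.log_mul two_ne_zero (by positivity)]
  nlinarith [mul_le_mul_of_nonneg_left hhalf (sub_nonneg.2 hk1)]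

theorem mul_log_div_sq_le_mul_log_div_pow_four {n : ℕ} (hn : n ≠ 1) (k : ℕ) {ε : ℝ} (hε : 0 < ε)
    (hε1 : ε ≤ 1) :
    64 * k * Real.log (2 * n * k) / ε ^ 2 ≤ 128 * k ^ 2 * Real.log n / ε ^ 4 := by
  have hlog : 0 ≤ Real.log n := Real.log_natCast_nonneg n
  have hmul : 64 * k * Real.log (2 * n * k) ≤ 128 * k ^ 2 * Real.log n := by
    rcases n.eq_zero_or_pos with rfl | hn0
    · simp
    rcases k.eq_zero_or_pos with rfl | hk
    · simp
    calc 64 * k * Real.log (2 * n * k) ≤ 64 * k * (2 * k * Real.log n) := by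
          gcongr
          exact log_two_mul_mul_le (by omega) hk
      _ = 128 * k ^ 2 * Real.log n := by ring
  exact div_le_div₀ (by positivity) hmul (by positivity)
    (pow_le_pow_of_le_one hε.le hε1 (by norm_num))

end SampleSize

theorem IsSmoothRegretApprox.mono [Fintype V] [DecidableEq V] {G : SimpleGraph V}
    [DecidableRel G.Adj] {C : Clustering V k} {g : Clustering V k → ℝ} {η η' : ℝ}
    (hg : IsSmoothRegretApprox G η C g) (hη : η ≤ η') : IsSmoothRegretApprox G η' C g := fun C' =>
  (hg C').trans (mul_le_mul_of_nonneg_right hη (dist_nonneg C C'))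

theorem isSmoothRegretApprox_estimator_of_isEmpty [Fintype V] [DecidableEq V] [IsEmpty V]
    (G : SimpleGraph V) [DecidableRel G.Adj] (η : ℝ) {C : Clustering V k} {q : ℕ}
    (S : Sample C q) : IsSmoothRegretApprox G η C (estimator G C S) := fun C' => by
  simp [regret, cost, dist, estimator, cluster]

end CorrClust

theorem lemma3_general {V : Type*} [Fintype V] [DecidableEq V] [MeasurableSpace V]
    [DiscreteMeasurableSpace V] (G : SimpleGraph V) [DecidableRel G.Adj] {k : ℕ}
    {C : CorrClust.Clustering V k}
    (hC : Antitone fun j : Fin k => (CorrClust.cluster C j).card)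
    {ε : ℝ} (hε : 0 < ε) (hε2 : ε ≤ 2) {q : ℕ}
    (hq : 64 * (k : ℝ) * Real.log (2 * Fintype.card V * k) / ε ^ 2 ≤ q) :
    1 - ((Fintype.card V : ℝ) ^ 3)⁻¹ ≤
      (CorrClust.sampleLaw C q).real
        {S | CorrClust.IsSmoothRegretApprox G (2 * ε) C (CorrClust.estimator G C S)} := by
  rcases isEmpty_or_nonempty V with hV | hV
  · simp [CorrClust.isSmoothRegretApprox_estimator_of_isEmpty]
  have hn : 1 ≤ Fintype.card V := Fintype.card_pos
  have hk : 1 ≤ k := (C hV.some).pos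
  have hx : Real.exp (-(q * ε ^ 2 / (16 * k))) ≤ ((2 * Fintype.card V * k : ℝ) ^ 4)⁻¹ := by
    rw [Real.exp_neg]
    refine inv_anti₀ (by positivity) ?_
    rw [← Real.log_le_iff_le_exp (by positivity), Real.log_pow, le_div_iff₀ (by positivity)]
    rw [div_le_iff₀ (by positivity)] at hq
    push_cast
    linarith
  have hbad := (CorrClust.measureReal_not_isSmoothRegretApprox_le (G := G) (q := q) hC hε.le
    hε2).trans (CorrClust.pow_four_mul_le_inv_cube hn hk (Real.exp_pos _).le hx)
  have hcompl := measureReal_union_le (μ := CorrClust.sampleLaw C q)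
    {S | CorrClust.IsSmoothRegretApprox G (2 * ε) C (CorrClust.estimator G C S)}
    {S | ¬CorrClust.IsSmoothRegretApprox G (2 * ε) C (CorrClust.estimator G C S)}
  rw [← Set.compl_ofPred, Set.union_compl_self, probReal_univ, Set.compl_ofPred] at hcompl
  linarith

theorem lemma3 :
    ∃ c₂ : ℝ, 0 < c₂ ∧
      ∀ (V : Type*) [Fintype V] [DecidableEq V] [MeasurableSpace V] [DiscreteMeasurableSpace V]
        (G : SimpleGraph V) [DecidableRel G.Adj] (k : ℕ) (C : CorrClust.Clustering V k)
        (_ : Antitone (fun j : Fin k => (CorrClust.cluster C j).card))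
        (ε : ℝ) (_ : 0 < ε) (_ : ε ≤ 1)
        (q : ℕ) (_ : c₂ * (k : ℝ) ^ 2 * Real.log (Fintype.card V) / ε ^ 4 ≤ (q : ℝ)),
        1 - ((Fintype.card V : ℝ) ^ 3)⁻¹ ≤
          (CorrClust.sampleLaw C q).real
            {S | CorrClust.IsSmoothRegretApprox G (3 * ε) C (CorrClust.estimator G C S)} := by
  refine ⟨128, by norm_num, fun V _ _ _ _ G _ k C hC ε hε hε1 q hq => ?_⟩
  rcases eq_or_ne (Fintype.card V) 1 with hn | hn
  · simp [hn]
  have hq' := (CorrClust.mul_log_div_sq_le_mul_log_div_pow_four hn k hε hε1).trans hq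
  exact (lemma3_general G hC hε (by linarith) hq').trans
    (measureReal_mono fun S hS => hS.mono (by linarith))
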